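/- Let $d\ge 1$, $d<p<\infty$, and let $\Omega\subset\mathbb R^d$ be a bounded domain (open, connected, non-empty) whose boundary is the disjoint union of two Borel sets $\partial\Omega_D$ and $\partial\Omega_N$. Let $\mathcal D(\Omega,\partial\Omega_D)$ be the set of restrictions to $\Omega$ of real-valued functions in $C_c^\infty(\mathbb R^d\setminus\partial\Omega_D)$, i.e. smooth functions on $\mathbb R^d$ whose support is compact and disjoint from $\partial\Omega_D$, and let $$\lambda_1(\Omega,\partial\Omega_D,p):=\inf\left\{\frac{\int_\Omega|\nabla\zeta|^p\,dx}{\int_\Omega|\zeta|^p\,dx}\;:\;\zeta\in\mathcal D(\Omega,\partial\Omega_D),\ \zeta\not\equiv0\right\}.$$ For $x\in\Omega$ and $u\in S^{d-1}$ let $d_u(x)$ be the length of the segment in direction $u$ joining $x$ to a point of $\partial\Omega_D$ and contained in $\Omega$ except for that end point ($d_u(x)=\infty$ if there is no such segment), and let $$\frac1{m(x)^p}:=\frac1{\omega_d}\int_{S^{d-1}}\frac{dS(u)}{d_u(x)^p},\qquad \omega_d=|S^{d-1}|,\qquad \frac1\infty:=0 .$$ Suppose that the origin is exterior to $\Omega$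 (that is, $0\notin\overline\Omega$), and that $\partial\Omega_N$ is starlike with respect to the origin with the exterior of $\Omega$ adjacent to $\partial\Omega_N$ lying away from the origin, in the following sense: for $\mathcal H^{d-1}$-almost every $y\in\partial\Omega_N$ there is $\varepsilon>0$ such that $ty\notin\Omega$ for all $1<t<1+\varepsilon$. Then for all $\zeta\in\mathcal D(\Omega,\partial\Omega_D)$, $$\int_\Omega|\nabla\zeta|^p\,dx\ \ge\ \left(\frac{p-d}{p}\right)^p\int_\Omega\left|\frac{\zeta}{|x|}\right|^p dx .$$ Consequently, $$\lambda_1(\Omega,\partial\Omega_D,p)\ \ge\ \left(\frac{p-d}{p\,\sup\{|x|:x\in\Omega\}}\right)^p .$$ Moreover, if $p\ge2$ (which is automatic when $d\ge2$), then for every $0\le\gamma\le1$, $$\lambda_1(\Omega,\partial\Omega_D,p)\ \ge\ \inf_{x\in\Omega}\left(\gamma\left(\frac{p-d}{p|x|}\right)^p+(1-\gamma)\frac{(p-1)^{p-2}}{p^p\,m(x)^p}\right).$$ -/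

import Mathlib

open MeasureTheory Set Metric
open scoped ENNReal ContDiff

noncomputable section

/-- Test functions adapted to the Dirichlet portion `ΓD` of the boundary: the functions in
`C_c^∞(ℝ^d \ ΓD)`, regarded as functions on `ℝ^d`. Only their restrictions to the domain `Ω`
are used below. -/
def IsTestFunction {d : ℕ} (ΓD : Set (EuclideanSpace ℝ (Fin d)))
    (ζ : EuclideanSpace ℝ (Fin d) → ℝ) : Prop :=
  ContDiff ℝ ∞ ζ ∧ HasCompactSupport ζ ∧ Disjoint (tsupport ζ) ΓD

/-- The fundamental eigenvalue `λ₁(Ω, ΓD, p)` of the `p`-Laplacian: the infimum of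
`∫_Ω |∇ζ|^p / ∫_Ω |ζ|^p` over the test functions that are not identically zero on `Ω`.
It is valued in `[0, ∞]`; all the integrals that occur are finite, and the denominators are
positive, when `Ω` is open and `0 < p`. -/
def fundamentalEigenvalue {d : ℕ} (Ω ΓD : Set (EuclideanSpace ℝ (Fin d))) (p : ℝ) : ℝ≥0∞ :=
  ⨅ (ζ : EuclideanSpace ℝ (Fin d) → ℝ) (_ : IsTestFunction ΓD ζ) (_ : ∃ x ∈ Ω, ζ x ≠ 0),
    (∫⁻ x in Ω, ‖gradient ζ x‖ₑ ^ p) / ∫⁻ x in Ω, ‖ζ x‖ₑ ^ p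

/-- The length `d_u(x)` of the segment contained in `Ω` that joins `x` to a point of `ΓD` in the
direction `u`; it is `∞` if there is no such segment. When `Ω` is open and `ΓD ⊆ ∂Ω`, at most one
`t` qualifies, because the end point `x + t u` is not in `Ω`. -/
def dirichletDist {d : ℕ} (Ω ΓD : Set (EuclideanSpace ℝ (Fin d)))
    (x u : EuclideanSpace ℝ (Fin d)) : ℝ≥0∞ :=
  ⨅ (t : ℝ) (_ : 0 < t ∧ x + t • u ∈ ΓD ∧ ∀ s ∈ Ico 0 t, x + s • u ∈ Ω), ENNReal.ofReal t

/-- `1 / m(x)^p`, where `m` is the averaged distance to the Dirichlet boundary: the mean over all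
directions `u` of the unit sphere of `1 / d_u(x)^p`. Directions outside the Dirichlet boundary
sector of `x` have `d_u(x) = ∞` and do not contribute. The measure is the surface measure of
`S^{d-1}`, and `ω_d` is its total mass. -/
def invMeanDistPow {d : ℕ} (Ω ΓD : Set (EuclideanSpace ℝ (Fin d))) (p : ℝ)
    (x : EuclideanSpace ℝ (Fin d)) : ℝ≥0∞ :=
  (∫⁻ u : sphere (0 : EuclideanSpace ℝ (Fin d)) 1,
      (dirichletDist Ω ΓD x u ^ p)⁻¹
        ∂(volume : Measure (EuclideanSpace ℝ (Fin d))).toSphere) /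
    (volume : Measure (EuclideanSpace ℝ (Fin d))).toSphere univ

/-- The boundary portion `Γ` is starlike with respect to the origin, with the exterior of `Ω`
adjacent to `Γ` lying away from the origin: at `(d-1)`-dimensionally almost every `y ∈ Γ`, the
points of the ray from `0` through `y` that come immediately after `y` are not in `Ω`.

This is weaker than asking that each such ray meet `Γ` once and pass there from `Ω` into the
complement of its closure. In terms of the outward normal `ν`, it says `ν(y) · y ≥ 0` almost
everywhere on a relatively open piece of `∂Ω` that is `C¹`; conical pieces, where `ν(y) · y = 0`,
are allowed. -/
def IsStarlikeExteriorAway {d : ℕ} (Ω Γ : Set (EuclideanSpace ℝ (Fin d))) : Prop :=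
  ∀ᵐ y ∂(Measure.hausdorffMeasure ((d : ℝ) - 1) : Measure (EuclideanSpace ℝ (Fin d))),
    y ∈ Γ → ∃ ε : ℝ, 0 < ε ∧ ∀ t ∈ Ioo 1 (1 + ε), t • y ∉ Ω

end

/-!
The three inequalities come from two Hardy inequalities, each proved by writing `ζ x` as an
integral of the gradient along a segment that starts or ends in `ΓD`, applying Hölder's
inequality with a power weight (`rpow_lintegral_le_lintegral_mul_weight`), and exchanging the
order of integration. The exponent of the weight is the one that makes both resulting integrals
equal, and so yields the sharp constants.

*Radial inequality.* For almost every `x ∈ Ω` the last point outside `Ω` of the segment `[0, x]`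
is a point of the frontier where the ray enters `Ω`. Starlikeness excludes that it lies outside
`ΓD` (`exists_smul_mem_of_starlike`), unless the ray meets an `ℋ^{d-1}`-null set. The cone over
such a set is Lebesgue null (`measure_cone_eq_zero_of_hausdorffMeasure_eq_zero`): the part in a
fixed ball of the cone over a set of diameter `δ` is covered by `O(1 / δ)` balls of radius
`O(δ)`. So `|ζ x| / |x| ≤ ∫₀¹ (1_Ω |∇ζ|)(s x) ds` almost everywhere, and since the dilation by `s`
multiplies `L^p` norms by `s ^ (-d / p)`, the constant is `∫₀¹ s ^ (-d / p) ds = p / (p - d)`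
(`lintegral_div_norm_rpow_le_of_radial`). Polar coordinates are not needed.

*Directional inequality.* For a unit vector `u`, integrating from `x` to the end point of its
segment in `ΓD` gives `((p - 1) / p) ^ p ∫ |ζ|^p / d_u^p ≤ ∫ |∇ζ|^p`
(`lintegral_rpow_mul_inv_rpow_le_of_direction`); the exchange of integrals uses that
`d_u (x + s u) = d_u x - s`. Averaging over `u` replaces `1 / d_u^p` by `1 / m^p`
(`lintegral_rpow_mul_invMeanDistPow_le`), and `(p - 1) ^ (p - 2) / p ^ p ≤ ((p - 1) / p) ^ p` when
`p ≥ 2`.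

A Hardy inequality with potential `V` gives `inf V ≤ λ₁` (`iInf_le_fundamentalEigenvalue`). The
second bound takes for `V` the radial potential, the third a convex combination of the two.
-/

/-! ### One-dimensional integrals and a weighted Hölder inequality -/

/-- Hölder's inequality for `f = (f * w ^ (1 / q)) * w ^ (-1 / q)`, `q` the exponent conjugate to
`p`. -/
lemma rpow_lintegral_le_lintegral_mul_weight {α : Type*} [MeasurableSpace α] {μ : Measure α}
    {p : ℝ} (hp : 1 < p) {f w : α → ℝ≥0∞} (hf : AEMeasurable f μ) (hw : AEMeasurable w μ)
    (hw0 : ∀ᵐ s ∂μ, w s ≠ 0 ∧ w s ≠ ⊤) :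
    (∫⁻ s, f s ∂μ) ^ p ≤
      (∫⁻ s, f s ^ p * w s ^ (p - 1) ∂μ) * (∫⁻ s, (w s)⁻¹ ∂μ) ^ (p - 1) := by
  have hp0 : 0 < p := by linarith
  have hp1 : 0 < p - 1 := by linarith
  have hpq := Real.HolderConjugate.conjExponent hp
  set q := p.conjExponent with hq
  have hqe : q = p / (p - 1) := rfl
  have hq0 : 0 < q := hpq.symm.pos
  have hH := ENNReal.lintegral_mul_le_Lp_mul_Lq μ hpq
    (hf.mul (hw.pow_const (1 / q))) (hw.pow_const (-(1 / q)))
  have e1 : ∫⁻ s, f s ∂μ =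
      ∫⁻ s, ((f * fun s => w s ^ (1 / q)) * fun s => w s ^ (-(1 / q))) s ∂μ := by
    refine lintegral_congr_ae ?_
    filter_upwards [hw0] with s hs
    simp only [Pi.mul_apply]
    rw [mul_assoc, ← ENNReal.rpow_add _ _ hs.1 hs.2]
    simp
  have e2 : ∀ s, (f s * w s ^ (1 / q)) ^ p = f s ^ p * w s ^ (p - 1) := by
    intro s
    rw [ENNReal.mul_rpow_of_nonneg _ _ hp0.le, ← ENNReal.rpow_mul]
    congr 2
    rw [hqe]; field_simp
  have e3 : ∀ s, (w s ^ (-(1 / q))) ^ q = (w s)⁻¹ := by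
    intro s
    rw [← ENNReal.rpow_mul, ← ENNReal.rpow_neg_one]
    congr 1
    field_simp
  simp only [Pi.mul_apply, e2, e3] at hH
  rw [e1]
  simp only [Pi.mul_apply]
  refine (ENNReal.rpow_le_rpow hH hp0.le).trans_eq ?_
  rw [ENNReal.mul_rpow_of_nonneg _ _ hp0.le, ← ENNReal.rpow_mul, ← ENNReal.rpow_mul,
    one_div_mul_cancel hp0.ne', ENNReal.rpow_one]
  congr 2
  rw [hqe]; field_simp

lemma enorm_sub_le_lintegral_gradient_segment {E : Type*} [NormedAddCommGroup E]
    [InnerProductSpace ℝ E] [CompleteSpace E] {ζ : E → ℝ} (hζ : ContDiff ℝ 1 ζ) (x v : E)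
    {a b : ℝ} (hab : a ≤ b) :
    ‖ζ (x + b • v) - ζ (x + a • v)‖ₑ ≤
      (∫⁻ s in Ioo a b, ‖gradient ζ (x + s • v)‖ₑ) * ‖v‖ₑ := by
  have hc : ContDiff ℝ 1 (fun s : ℝ => ζ (x + s • v)) := hζ.comp (by fun_prop)
  refine (enorm_sub_le_lintegral_deriv_of_contDiffOn_Icc hc.contDiffOn hab).trans ?_
  rw [← lintegral_mul_const' _ _ enorm_ne_top, restrict_Ioo_eq_restrict_Icc]
  refine lintegral_mono fun s => ?_
  have hd : HasDerivAt (fun s : ℝ => ζ (x + s • v)) (fderiv ℝ ζ (x + s • v) v) s := by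
    have h1 : HasDerivAt (fun s : ℝ => x + s • v) v s := by
      simpa using ((hasDerivAt_id s).smul_const v).const_add x
    exact ((hζ.differentiable one_ne_zero _).hasFDerivAt).comp_hasDerivAt s h1
  rw [hd.deriv]
  have : ‖gradient ζ (x + s • v)‖ₑ = ‖fderiv ℝ ζ (x + s • v)‖ₑ := by
    simp [gradient, enorm_eq_nnnorm]
  simp only [this]
  exact ContinuousLinearMap.le_opENorm _ _

lemma setLIntegral_Ioo_rpow_neg {r : ℝ} (hr : r < 1) {t : ℝ} (ht : 0 < t) :
    ∫⁻ s in Ioo 0 t, (ENNReal.ofReal s ^ r)⁻¹ = ENNReal.ofReal (t ^ (1 - r) / (1 - r)) := by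
  have hint : IntervalIntegrable (fun s : ℝ => s ^ (-r)) volume 0 t :=
    intervalIntegral.intervalIntegrable_rpow' (by linarith)
  have h := integral_rpow (a := 0) (b := t) (r := -r) (Or.inl (by linarith))
  rw [intervalIntegral.integral_of_le ht.le, Real.zero_rpow (by linarith), sub_zero,
    neg_add_eq_sub] at h
  rw [← h, ofReal_integral_eq_lintegral_ofReal
    ((intervalIntegrable_iff_integrableOn_Ioc_of_le ht.le).1 hint)
    ((ae_restrict_mem measurableSet_Ioc).mono fun s hs => Real.rpow_nonneg hs.1.le _),
    restrict_Ioo_eq_restrict_Ioc]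
  refine setLIntegral_congr_fun measurableSet_Ioc fun s hs => ?_
  rw [← ENNReal.rpow_neg, ENNReal.ofReal_rpow_of_pos hs.1]

lemma setLIntegral_Ioo_sub_rpow_neg {r : ℝ} (hr : r < 1) {t : ℝ} (ht : 0 < t) :
    ∫⁻ s in Ioo 0 t, (ENNReal.ofReal (t - s) ^ r)⁻¹ = ENNReal.ofReal (t ^ (1 - r) / (1 - r)) := by
  rw [← setLIntegral_Ioo_rpow_neg hr ht]
  have hm : MeasurePreserving (fun s : ℝ => t - s) volume volume :=
    Measure.measurePreserving_sub_left volume t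
  have h := hm.setLIntegral_comp_preimage (s := Ioo 0 t) measurableSet_Ioo
    (f := fun s => (ENNReal.ofReal s ^ r)⁻¹) (by fun_prop)
  simpa using h

lemma setLIntegral_Ioi_add_rpow_neg {κ : ℝ} (hκ : 0 < κ) {t : ℝ} (ht : 0 < t) :
    ∫⁻ s in Ioi 0, (ENNReal.ofReal t + ENNReal.ofReal s) ^ (-1 - κ)
      = ENNReal.ofReal (t ^ (-κ) / κ) := by
  have h := integral_Ioi_rpow_of_lt (a := -1 - κ) (by linarith) ht
  have e : -t ^ (-1 - κ + 1) / (-1 - κ + 1) = t ^ (-κ) / κ := by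
    rw [show -1 - κ + 1 = -κ by ring, neg_div_neg_eq]
  rw [e] at h
  rw [← h, ofReal_integral_eq_lintegral_ofReal
    (integrableOn_Ioi_rpow_of_lt (by linarith) ht)
    ((ae_restrict_mem measurableSet_Ioi).mono
      fun s hs => Real.rpow_nonneg (ht.trans hs).le _)]
  have hm : MeasurePreserving (fun s : ℝ => t + s) volume volume :=
    measurePreserving_add_left volume t
  have h2 := hm.setLIntegral_comp_preimage (s := Ioi t) measurableSet_Ioi
    (f := fun s => ENNReal.ofReal (s ^ (-1 - κ))) (by fun_prop)
  rw [← h2]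
  have : (fun s : ℝ => t + s) ⁻¹' Ioi t = Ioi 0 := by ext s; simp
  rw [this]
  refine setLIntegral_congr_fun measurableSet_Ioi fun s hs => ?_
  have hs' : 0 < s := hs
  rw [← ENNReal.ofReal_add ht.le hs'.le, ENNReal.ofReal_rpow_of_pos (by linarith)]

/-! ### Cones over Hausdorff null sets -/

section Cone

variable {E : Type*} [NormedAddCommGroup E] [NormedSpace ℝ E]

/-- The truncated cone over `A` with vertex `0`: the multiples `s • y` of points of `A` with
`0 ≤ s ≤ R`. -/
def truncatedCone (R : ℝ) (A : Set E) : Set E := {x | ∃ s ∈ Icc 0 R, ∃ y ∈ A, s • y = x}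

variable [FiniteDimensional ℝ E] [MeasurableSpace E] [BorelSpace E]
  (μ : Measure E) [μ.IsAddHaarMeasure] {m : ℕ}

/-- The cone is covered by about `R / δ` balls of radius `2 R δ`, centred at multiples of one point
of `A`. -/
lemma measure_truncatedCone_le_of_ediam_le (hm : Module.finrank ℝ E = m + 1) {R δ : ℝ}
    (hR : 0 ≤ R) (hδ0 : 0 < δ) (hδ1 : δ ≤ 1) {A : Set E} (hA : A ⊆ closedBall 0 R)
    (hAδ : ediam A ≤ ENNReal.ofReal δ) :
    μ (truncatedCone R A) ≤
      ENNReal.ofReal ((R + 1) * (2 * R) ^ (m + 1)) * μ (ball 0 1) * ENNReal.ofReal (δ ^ m) := by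
  rcases A.eq_empty_or_nonempty with rfl | ⟨a, ha⟩
  · simp [truncatedCone]
  have hsub : truncatedCone R A ⊆
      ⋃ k ∈ Finset.range (⌊R / δ⌋₊ + 1), closedBall ((k * δ) • a) (2 * R * δ) := by
    rintro x ⟨s, ⟨hs0, hsR⟩, y, hy, rfl⟩
    have hsδ : 0 ≤ s / δ := by positivity
    simp only [mem_iUnion]
    refine ⟨⌊s / δ⌋₊, ?_, ?_⟩
    · rw [Finset.mem_range, Nat.lt_succ_iff]
      exact Nat.floor_le_floor (by gcongr)
    have h1 : ⌊s / δ⌋₊ * δ ≤ s := (le_div_iff₀ hδ0).1 (Nat.floor_le hsδ)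
    have h2 : s < (⌊s / δ⌋₊ + 1) * δ := (div_lt_iff₀ hδ0).1 (Nat.lt_floor_add_one _)
    have h3 : ‖y - a‖ ≤ δ := by
      rw [← dist_eq_norm]
      have := (edist_le_ediam_of_mem hy ha).trans hAδ
      rwa [edist_dist, ENNReal.ofReal_le_ofReal_iff hδ0.le] at this
    have h4 : ‖y‖ ≤ R := by simpa using hA hy
    have h5 : (0 : ℝ) ≤ ⌊s / δ⌋₊ * δ := by positivity
    rw [mem_closedBall, dist_eq_norm]
    calc ‖s • y - (⌊s / δ⌋₊ * δ) • a‖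
        = ‖(s - ⌊s / δ⌋₊ * δ) • y + (⌊s / δ⌋₊ * δ) • (y - a)‖ := by
          congr 1; rw [sub_smul, smul_sub]; abel
      _ ≤ (s - ⌊s / δ⌋₊ * δ) * ‖y‖ + (⌊s / δ⌋₊ * δ) * ‖y - a‖ := by
          refine (norm_add_le _ _).trans_eq ?_
          rw [norm_smul, norm_smul, Real.norm_of_nonneg (by linarith), Real.norm_of_nonneg h5]
      _ ≤ δ * R + R * δ := by
          gcongr
          · linarith
          · linarith
      _ = 2 * R * δ := by ring
  calc μ (truncatedCone R A)
      ≤ ∑ k ∈ Finset.range (⌊R / δ⌋₊ + 1), μ (closedBall ((k * δ) • a) (2 * R * δ)) :=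
        (measure_mono hsub).trans (measure_biUnion_finset_le _ _)
    _ = ENNReal.ofReal ((⌊R / δ⌋₊ + 1) * (2 * R * δ) ^ (m + 1)) * μ (ball 0 1) := by
        rw [ENNReal.ofReal_mul (by positivity), ENNReal.ofReal_add (by positivity) zero_le_one,
          ENNReal.ofReal_natCast, ENNReal.ofReal_one]
        have hball : ∀ c : E, μ (closedBall c (2 * R * δ)) =
            ENNReal.ofReal ((2 * R * δ) ^ (m + 1)) * μ (ball 0 1) := fun c => by
          rw [Measure.addHaar_closedBall μ c (by positivity), hm]
        simp only [hball, Finset.sum_const, Finset.card_range, nsmul_eq_mul]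
        push_cast
        exact (mul_assoc _ _ _).symm
    _ ≤ ENNReal.ofReal ((R + 1) * (2 * R) ^ (m + 1) * δ ^ m) * μ (ball 0 1) := by
        gcongr ENNReal.ofReal ?_ * _
        have h1 : (⌊R / δ⌋₊ : ℝ) * δ ≤ R := (le_div_iff₀ hδ0).1 (Nat.floor_le (by positivity))
        calc (⌊R / δ⌋₊ + 1) * (2 * R * δ) ^ (m + 1)
            = (⌊R / δ⌋₊ * δ + δ) * ((2 * R) ^ (m + 1) * δ ^ m) := by ring
          _ ≤ (R + 1) * ((2 * R) ^ (m + 1) * δ ^ m) := by gcongr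
          _ = _ := by ring
    _ = _ := by
        rw [ENNReal.ofReal_mul (by positivity)]
        ring

/-- Sets of diameter zero are included: their cones are segments, which are null sets unless the
space is a line, and `0 ^ 0 = 1` in that case. -/
lemma measure_truncatedCone_le (hm : Module.finrank ℝ E = m + 1) {R : ℝ} (hR : 0 ≤ R)
    {A : Set E} (hA : A ⊆ closedBall 0 R) (hA1 : ediam A < 1) :
    μ (truncatedCone R A) ≤
      ENNReal.ofReal ((R + 1) * (2 * R) ^ (m + 1)) * μ (ball 0 1) * ediam A ^ m := by
  set D := (ediam A).toReal with hD
  have hAD : ediam A = ENNReal.ofReal D := (ENNReal.ofReal_toReal hA1.ne_top).symm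
  have hD0 : 0 ≤ D := ENNReal.toReal_nonneg
  have hD1 : D < 1 := by
    rw [hAD] at hA1; simpa using hA1
  have hC : ENNReal.ofReal ((R + 1) * (2 * R) ^ (m + 1)) * μ (ball 0 1) ≠ ⊤ :=
    ENNReal.mul_ne_top ENNReal.ofReal_ne_top measure_ball_lt_top.ne
  have hlim : Filter.Tendsto (fun δ : ℝ => ENNReal.ofReal ((R + 1) * (2 * R) ^ (m + 1)) *
      μ (ball 0 1) * ENNReal.ofReal (δ ^ m)) (nhdsWithin D (Ioi D))
      (nhds (ENNReal.ofReal ((R + 1) * (2 * R) ^ (m + 1)) * μ (ball 0 1) *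
        ENNReal.ofReal (D ^ m))) := by
    refine ENNReal.Tendsto.const_mul ?_ (Or.inr hC)
    exact (ENNReal.continuous_ofReal.comp (continuous_pow m)).continuousWithinAt
  rw [hAD, ← ENNReal.ofReal_pow hD0]
  refine ge_of_tendsto hlim ?_
  filter_upwards [Ioo_mem_nhdsGT hD1] with δ hδ
  refine measure_truncatedCone_le_of_ediam_le μ hm hR (hD0.trans_lt hδ.1) hδ.2.le hA ?_
  rw [hAD]
  exact ENNReal.ofReal_le_ofReal hδ.1.le

/-- A cone over a set of vanishing `m`-dimensional measure is a null set in dimension `m + 1`. -/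
lemma measure_cone_eq_zero_of_hausdorffMeasure_eq_zero (hm : Module.finrank ℝ E = m + 1)
    {N : Set E} (hN : Measure.hausdorffMeasure (m : ℝ) N = 0) :
    μ {x | ∃ s : ℝ, 0 ≤ s ∧ ∃ y ∈ N, s • y = x} = 0 := by
  have hR : ∀ R : ℕ, μ (truncatedCone R (N ∩ closedBall 0 R)) = 0 := by
    intro R
    set C := ENNReal.ofReal (((R : ℝ) + 1) * (2 * R) ^ (m + 1)) * μ (ball 0 1) with hCdef
    have hC : C ≠ ⊤ := ENNReal.mul_ne_top ENNReal.ofReal_ne_top measure_ball_lt_top.ne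
    have key : ∀ ε : ℝ≥0∞, 0 < ε → μ (truncatedCone R (N ∩ closedBall 0 R)) ≤ C * ε := by
      intro ε hε
      rw [Measure.hausdorffMeasure_apply] at hN
      have h2 : (0 : ℝ≥0∞) < 2⁻¹ := by simp
      have h0 := (ENNReal.iSup_eq_zero.1 (ENNReal.iSup_eq_zero.1 hN 2⁻¹) h2)
      rw [← h0] at hε
      simp only [iInf_lt_iff] at hε
      obtain ⟨t, htN, htd, hsum⟩ := hε
      have hsub : truncatedCone R (N ∩ closedBall 0 R) ⊆
          ⋃ n, truncatedCone (R : ℝ) (t n ∩ closedBall 0 R) := by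
        rintro x ⟨s, hs, y, ⟨hyN, hyR⟩, rfl⟩
        obtain ⟨n, hn⟩ := mem_iUnion.1 (htN hyN)
        exact mem_iUnion.2 ⟨n, s, hs, y, ⟨hn, hyR⟩, rfl⟩
      calc μ (truncatedCone R (N ∩ closedBall 0 R))
          ≤ ∑' n, μ (truncatedCone (R : ℝ) (t n ∩ closedBall 0 R)) :=
            (measure_mono hsub).trans (measure_iUnion_le _)
        _ ≤ ∑' n, C * ⨆ _ : (t n).Nonempty, ediam (t n) ^ (m : ℝ) := by
            refine ENNReal.tsum_le_tsum fun n => ?_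
            rcases (t n).eq_empty_or_nonempty with h | h
            · simp [h, truncatedCone]
            have hle : ediam (t n ∩ closedBall 0 (R : ℝ)) ≤ ediam (t n) :=
              ediam_mono inter_subset_left
            refine (measure_truncatedCone_le μ hm (Nat.cast_nonneg R) inter_subset_right
              (hle.trans_lt ((htd n).trans_lt (by simp)))).trans ?_
            simp only [h, iSup_pos, ENNReal.rpow_natCast]
            gcongr
        _ = C * ∑' n, ⨆ _ : (t n).Nonempty, ediam (t n) ^ (m : ℝ) := ENNReal.tsum_mul_left
        _ ≤ C * ε := by gcongr
    have hlim : Filter.Tendsto (fun ε : ℝ≥0∞ => C * ε) (nhdsWithin 0 (Ioi 0)) (nhds (C * 0)) :=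
      (ENNReal.Tendsto.const_mul Filter.tendsto_id (Or.inr hC)).mono_left nhdsWithin_le_nhds
    rw [mul_zero] at hlim
    exact le_antisymm (ge_of_tendsto hlim (by
      filter_upwards [self_mem_nhdsWithin] with ε hε using key ε hε)) zero_le
  refine measure_mono_null ?_ (measure_iUnion_null hR)
  rintro x ⟨s, hs, y, hy, rfl⟩
  obtain ⟨n, hn⟩ := exists_nat_ge (max s ‖y‖)
  exact mem_iUnion.2 ⟨n, s, ⟨hs, (le_max_left _ _).trans hn⟩, y,
    ⟨hy, by simpa using (le_max_right _ _).trans hn⟩, rfl⟩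

end Cone

/-! ### The radial Hardy inequality -/

/-- The last point outside `Ω` of the segment from `0` to a point `x` of `Ω` is a boundary point
through which the ray from `0` enters `Ω`. The starlikeness condition fails there, so it is in
`ΓD`. -/
lemma exists_smul_mem_of_starlike {E : Type*} [NormedAddCommGroup E] [NormedSpace ℝ E]
    {Ω ΓD : Set E} (hΩ : IsOpen Ω) (h0 : (0 : E) ∉ closure Ω) {x : E} (hx : x ∈ Ω)
    (h : ∀ y ∈ frontier Ω \ ΓD, (∃ s : ℝ, 0 ≤ s ∧ s • y = x) →
      ∃ ε : ℝ, 0 < ε ∧ ∀ t ∈ Ioo 1 (1 + ε), t • y ∉ Ω) :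
    ∃ a ∈ Ioo (0 : ℝ) 1, a • x ∈ ΓD ∧ ∀ s ∈ Ioo a 1, s • x ∈ Ω := by
  have hcont : Continuous fun s : ℝ => s • x := by fun_prop
  have hcomp : IsCompact (Icc (0 : ℝ) 1 ∩ (fun s : ℝ => s • x) ⁻¹' Ωᶜ) :=
    isCompact_Icc.inter_right (hΩ.isClosed_compl.preimage hcont)
  obtain ⟨a, ⟨⟨ha0, ha1⟩, haΩ⟩, hmax⟩ := hcomp.exists_isGreatest
    ⟨0, ⟨le_rfl, zero_le_one⟩, by simpa using fun h => h0 (subset_closure h)⟩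
  have haΩ' : a • x ∉ Ω := haΩ
  have ha1' : a < 1 := lt_of_le_of_ne ha1 fun h => haΩ' (by simpa [h] using hx)
  have hin : ∀ s ∈ Ioo a 1, s • x ∈ Ω := fun s hs => by
    by_contra hn
    exact absurd (hmax ⟨⟨ha0.trans hs.1.le, hs.2.le⟩, hn⟩) (not_le.2 hs.1)
  have hcl : a • x ∈ closure Ω := by
    refine mem_closure_of_tendsto (hcont.continuousWithinAt (s := Ioi a) (x := a)) ?_
    filter_upwards [Ioo_mem_nhdsGT ha1'] with s hs using hin s hs
  have ha0' : 0 < a := lt_of_le_of_ne ha0 fun h => h0 (by simpa [← h] using hcl)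
  refine ⟨a, ⟨ha0', ha1'⟩, ?_, hin⟩
  by_contra hD
  have hfr : a • x ∈ frontier Ω := by
    rw [hΩ.frontier_eq]; exact ⟨hcl, haΩ'⟩
  obtain ⟨ε, hε, hout⟩ := h _ ⟨hfr, hD⟩ ⟨a⁻¹, by positivity, inv_smul_smul₀ ha0'.ne' x⟩
  -- A point just beyond `a • x` would be in `Ω` by the choice of `a`, and outside it by `hout`.
  obtain ⟨t, ht1, ht2⟩ := exists_between
    (show 1 < min (1 + ε) a⁻¹ from lt_min (by linarith) ((one_lt_inv₀ ha0').2 ha1'))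
  refine hout t ⟨ht1, ht2.trans_le (min_le_left _ _)⟩ ?_
  rw [smul_smul]
  refine hin _ ⟨lt_mul_of_one_lt_left ha0' ht1, ?_⟩
  calc t * a < a⁻¹ * a := by gcongr; exact ht2.trans_le (min_le_right _ _)
    _ = 1 := inv_mul_cancel₀ ha0'.ne'

section Hardy

variable {E : Type*} [NormedAddCommGroup E] [InnerProductSpace ℝ E] [FiniteDimensional ℝ E]
  [MeasurableSpace E] [BorelSpace E]

lemma measurable_enorm_gradient {ζ : E → ℝ} (hζ : ContDiff ℝ 1 ζ) :
    Measurable fun x => ‖gradient ζ x‖ₑ := by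
  have : Continuous (gradient ζ) :=
    (InnerProductSpace.toDual ℝ E).symm.continuous.comp (hζ.continuous_fderiv one_ne_zero)
  exact this.measurable.enorm

lemma lintegral_comp_smul_of_pos {f : E → ℝ≥0∞} (hf : Measurable f) {s : ℝ} (hs : 0 < s) :
    ∫⁻ x, f (s • x) = (ENNReal.ofReal s ^ (Module.finrank ℝ E : ℝ))⁻¹ * ∫⁻ x, f x := by
  rw [← lintegral_map hf (measurable_const_smul s), Measure.map_addHaar_smul _ hs.ne',
    lintegral_smul_measure, abs_of_pos (by positivity), ENNReal.ofReal_inv_of_pos (by positivity),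
    ENNReal.ofReal_pow hs.le, ENNReal.rpow_natCast, smul_eq_mul]

/-- Hardy's inequality for functions that vanish where the rays from `0` enter `Ω`. Writing
`ζ x / |x|` as an average of the gradient over the dilates `s • x`, `0 < s < 1`, the constant is
`∫ s ^ (-d / p) ds`, as in Minkowski's integral inequality. -/
lemma lintegral_div_norm_rpow_le_of_radial {ζ : E → ℝ} (hζ : ContDiff ℝ 1 ζ) {p : ℝ}
    (hp1 : 1 < p) (hp : (Module.finrank ℝ E : ℝ) < p) {Ω : Set E} (hΩ : IsOpen Ω)
    (h : ∀ᵐ x ∂(volume.restrict Ω),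
      ∃ a ∈ Ioo (0 : ℝ) 1, ζ (a • x) = 0 ∧ ∀ s ∈ Ioo a 1, s • x ∈ Ω) :
    ENNReal.ofReal (((p - Module.finrank ℝ E) / p) ^ p) * (∫⁻ x in Ω, (‖ζ x‖ₑ / ‖x‖ₑ) ^ p)
      ≤ ∫⁻ x in Ω, ‖gradient ζ x‖ₑ ^ p := by
  set d := Module.finrank ℝ E
  have hp0 : 0 < p := by linarith
  have hpd : 0 < p - d := by linarith
  set G : E → ℝ≥0∞ := Ω.indicator fun x => ‖gradient ζ x‖ₑ with hG
  have hGm : Measurable G := (measurable_enorm_gradient hζ).indicator hΩ.measurableSet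
  have hGs : Measurable fun z : E × ℝ => G (z.2 • z.1) :=
    hGm.comp (measurable_snd.smul measurable_fst)
  have hGp : ∫⁻ x, G x ^ p = ∫⁻ x in Ω, ‖gradient ζ x‖ₑ ^ p := by
    rw [← lintegral_indicator hΩ.measurableSet]
    refine lintegral_congr fun x => ?_
    by_cases hx : x ∈ Ω <;> simp [hG, hx, hp0]
  have hpt : ∀ᵐ x ∂(volume.restrict Ω), ‖ζ x‖ₑ / ‖x‖ₑ ≤ ∫⁻ s in Ioo (0 : ℝ) 1, G (s • x) := by
    filter_upwards [h] with x ⟨a, ha, haζ, haΩ⟩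
    have h1 := enorm_sub_le_lintegral_gradient_segment hζ 0 x ha.2.le
    simp only [zero_add, one_smul, haζ, sub_zero] at h1
    refine ENNReal.div_le_of_le_mul (h1.trans ?_)
    gcongr ?_ * _
    calc ∫⁻ s in Ioo a 1, ‖gradient ζ (s • x)‖ₑ = ∫⁻ s in Ioo a 1, G (s • x) := by
          refine setLIntegral_congr_fun measurableSet_Ioo fun s hs => ?_
          simp [hG, haΩ s hs]
      _ ≤ _ := lintegral_mono_set (Ioo_subset_Ioo_left ha.1.le)
  set r : ℝ := d / p with hr
  have hr1 : r < 1 := (div_lt_one hp0).2 hp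
  set K : ℝ≥0∞ := ∫⁻ s in Ioo (0 : ℝ) 1, (ENNReal.ofReal s ^ r)⁻¹ with hK
  have hKval : K = ENNReal.ofReal (p / (p - d)) := by
    rw [hK, setLIntegral_Ioo_rpow_neg hr1 one_pos, Real.one_rpow, hr]
    congr 1; field_simp
  have hw : Measurable fun s : ℝ => ENNReal.ofReal s ^ r := by fun_prop
  have hw0 : ∀ s : ℝ, 0 < s → ENNReal.ofReal s ^ r ≠ 0 ∧ ENNReal.ofReal s ^ r ≠ ⊤ := fun s hs =>
    ⟨(ENNReal.rpow_pos (by simpa using hs) ENNReal.ofReal_ne_top).ne',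
      ENNReal.rpow_ne_top_of_nonneg (by positivity) ENNReal.ofReal_ne_top⟩
  have hmain : ∫⁻ x in Ω, (‖ζ x‖ₑ / ‖x‖ₑ) ^ p ≤ K ^ p * ∫⁻ x, G x ^ p := by
    calc ∫⁻ x in Ω, (‖ζ x‖ₑ / ‖x‖ₑ) ^ p
        ≤ ∫⁻ x in Ω, (∫⁻ s in Ioo (0 : ℝ) 1, G (s • x) ^ p * (ENNReal.ofReal s ^ r) ^ (p - 1))
            * K ^ (p - 1) := by
          refine lintegral_mono_ae ?_
          filter_upwards [hpt] with x hx
          refine (ENNReal.rpow_le_rpow hx hp0.le).trans ?_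
          refine rpow_lintegral_le_lintegral_mul_weight hp1
            (hGs.comp measurable_prodMk_left).aemeasurable hw.aemeasurable ?_
          filter_upwards [ae_restrict_mem measurableSet_Ioo] with s hs using hw0 s hs.1
      _ ≤ ∫⁻ x, (∫⁻ s in Ioo (0 : ℝ) 1, G (s • x) ^ p * (ENNReal.ofReal s ^ r) ^ (p - 1))
            * K ^ (p - 1) := lintegral_mono' Measure.restrict_le_self le_rfl
      _ = (∫⁻ s in Ioo (0 : ℝ) 1, ∫⁻ x, G (s • x) ^ p * (ENNReal.ofReal s ^ r) ^ (p - 1))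
            * K ^ (p - 1) := by
          have hm : Measurable fun z : E × ℝ =>
              G (z.2 • z.1) ^ p * (ENNReal.ofReal z.2 ^ r) ^ (p - 1) :=
            (hGs.pow_const _).mul ((hw.comp measurable_snd).pow_const _)
          rw [lintegral_mul_const _ hm.lintegral_prod_right', lintegral_lintegral_swap]
          exact hm.aemeasurable
      _ = (∫⁻ s in Ioo (0 : ℝ) 1, (ENNReal.ofReal s ^ r)⁻¹ * ∫⁻ x, G x ^ p) * K ^ (p - 1) := by
          congr 1
          refine setLIntegral_congr_fun measurableSet_Ioo fun s hs => ?_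
          have hs0 : ENNReal.ofReal s ≠ 0 := by simpa using hs.1
          have hGsm : Measurable fun x => G (s • x) := hGm.comp (measurable_const_smul s)
          rw [lintegral_mul_const _ (hGsm.pow_const p),
            lintegral_comp_smul_of_pos (hGm.pow_const p) hs.1, mul_right_comm]
          congr 1
          rw [← ENNReal.rpow_mul, ← ENNReal.rpow_neg, ← ENNReal.rpow_neg,
            ← ENNReal.rpow_add _ _ hs0 ENNReal.ofReal_ne_top]
          congr 1
          rw [hr]; field_simp; ring
      _ = K ^ p * ∫⁻ x, G x ^ p := by
          have hKp : K ^ p = K * K ^ (p - 1) := by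
            conv_lhs => rw [show p = 1 + (p - 1) by ring]
            rw [ENNReal.rpow_add_of_nonneg _ _ zero_le_one (by linarith), ENNReal.rpow_one]
          have hwi : Measurable fun s : ℝ => (ENNReal.ofReal s ^ r)⁻¹ := hw.inv
          rw [lintegral_mul_const _ hwi, hKp]
          ring
  rw [← hGp]
  calc _ ≤ ENNReal.ofReal (((p - d) / p) ^ p) * (K ^ p * ∫⁻ x, G x ^ p) := by gcongr
    _ = ∫⁻ x, G x ^ p := by
        rw [← mul_assoc, hKval, ENNReal.ofReal_rpow_of_nonneg (by positivity) hp0.le,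
          ← ENNReal.ofReal_mul (by positivity), ← Real.mul_rpow (by positivity) (by positivity)]
        rw [div_mul_div_cancel₀ hp0.ne', div_self hpd.ne']
        simp

end Hardy

/-! ### The directional Hardy inequality -/

section Directional

variable {E : Type*} [NormedAddCommGroup E] [InnerProductSpace ℝ E] [FiniteDimensional ℝ E]
  [MeasurableSpace E] [BorelSpace E]

/-- Hardy's inequality in a fixed direction `u`, with respect to a function `D` that decreases at
unit speed along `u` wherever it is finite, down to a zero of `ζ`.

No decomposition into lines is needed: the weighted Hölder inequality bounds the left side by an
integral over `(x, s)`, and the translation `y = x + s • u`, under which `D y = D x - s`, turns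
its integral over `s` into a power of `D y`. -/
lemma lintegral_rpow_mul_inv_rpow_le_of_direction {ζ : E → ℝ} (hζ : ContDiff ℝ 1 ζ) {p : ℝ}
    (hp : 1 < p) {u : E} (hu : ‖u‖ = 1) {D : E → ℝ≥0∞} (hDm : Measurable D)
    (hD0 : ∀ x, D x ≠ 0)
    (hDζ : ∀ x, ∀ t : ℝ, 0 < t → D x = ENNReal.ofReal t → ζ (x + t • u) = 0)
    (hDsub : ∀ x, ∀ s : ℝ, 0 < s → ENNReal.ofReal s < D x → D x ≠ ⊤ →
      D (x + s • u) = D x - ENNReal.ofReal s)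
    {Ω : Set E} (hΩ : ∀ x ∉ Ω, D x = ⊤) (hΩm : MeasurableSet Ω) :
    ENNReal.ofReal (((p - 1) / p) ^ p) * (∫⁻ x in Ω, ‖ζ x‖ₑ ^ p * (D x ^ p)⁻¹)
      ≤ ∫⁻ x in Ω, ‖gradient ζ x‖ₑ ^ p := by
  have hp0 : 0 < p := by linarith
  have hp1 : 0 < p - 1 := by linarith
  set κ : ℝ := 1 - 1 / p with hκ
  have hκe : κ = (p - 1) / p := by rw [hκ]; field_simp
  have hκ0 : 0 < κ := by rw [hκe]; positivity
  set k : ℝ≥0∞ := ENNReal.ofReal κ⁻¹ with hk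
  set G : E → ℝ≥0∞ := fun x => ‖gradient ζ x‖ₑ with hG
  have hGm : Measurable G := measurable_enorm_gradient hζ
  -- The kernel that the weighted Hölder inequality produces.
  set F : E × ℝ → ℝ≥0∞ := fun z =>
    {z : E × ℝ | ENNReal.ofReal z.2 < D z.1 ∧ D z.1 ≠ ⊤}.indicator (fun z =>
      G (z.1 + z.2 • u) ^ p * (D z.1 - ENNReal.ofReal z.2) ^ κ * D z.1 ^ (-1 - κ)) z with hF
  have hFm : Measurable F := by
    have h1 : Measurable fun z : E × ℝ => G (z.1 + z.2 • u) := hGm.comp (by fun_prop)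
    have h2 : Measurable fun z : E × ℝ => D z.1 := hDm.comp measurable_fst
    have h3 : Measurable fun z : E × ℝ => ENNReal.ofReal z.2 := by fun_prop
    refine Measurable.indicator ?_ ?_
    · exact ((h1.pow_const p).mul ((h2.sub h3).pow_const κ)).mul (h2.pow_const _)
    · exact (measurableSet_lt h3 h2).inter (h2 (measurableSet_singleton ⊤)).compl
  have hpt : ∀ x, ‖ζ x‖ₑ ^ p * (D x ^ p)⁻¹ ≤ k ^ (p - 1) * ∫⁻ s in Ioi (0 : ℝ), F (x, s) := by
    intro x
    by_cases hx : D x = ⊤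
    · simp [hx, hp0]
    set t := (D x).toReal with ht
    have hDt : D x = ENNReal.ofReal t := (ENNReal.ofReal_toReal hx).symm
    have ht0 : 0 < t := ENNReal.toReal_pos (hD0 x) hx
    have h1 : ‖ζ x‖ₑ ≤ ∫⁻ s in Ioo 0 t, G (x + s • u) := by
      have h := enorm_sub_le_lintegral_gradient_segment hζ x u ht0.le
      have hu' : ‖u‖ₑ = 1 := by rw [← ofReal_norm, hu, ENNReal.ofReal_one]
      rwa [hDζ x t ht0 hDt, zero_smul, add_zero, zero_sub, enorm_neg, hu', mul_one] at h
    have hw0 : ∀ᵐ s ∂(volume.restrict (Ioo 0 t)), ENNReal.ofReal (t - s) ^ (1 / p) ≠ 0 ∧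
        ENNReal.ofReal (t - s) ^ (1 / p) ≠ ⊤ := by
      filter_upwards [ae_restrict_mem measurableSet_Ioo] with s hs
      exact ⟨(ENNReal.rpow_pos (by simpa using hs.2) ENNReal.ofReal_ne_top).ne',
        ENNReal.rpow_ne_top_of_nonneg (by positivity) ENNReal.ofReal_ne_top⟩
    have h2 := rpow_lintegral_le_lintegral_mul_weight hp
      (f := fun s : ℝ => G (x + s • u)) (w := fun s => ENNReal.ofReal (t - s) ^ (1 / p))
      (hGm.comp (by fun_prop)).aemeasurable (by fun_prop) hw0
    rw [setLIntegral_Ioo_sub_rpow_neg ((div_lt_one hp0).2 hp) ht0, ← hκ] at h2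
    have h3 : ENNReal.ofReal (t ^ κ / κ) ^ (p - 1) * (D x ^ p)⁻¹
        = k ^ (p - 1) * D x ^ (-1 - κ) := by
      rw [div_eq_mul_inv, ENNReal.ofReal_mul (by positivity), ← hk,
        ENNReal.mul_rpow_of_nonneg _ _ hp1.le, ← ENNReal.ofReal_rpow_of_pos ht0, ← hDt,
        ← ENNReal.rpow_mul, mul_comm _ (k ^ (p - 1)), mul_assoc, ← ENNReal.rpow_neg,
        ← ENNReal.rpow_add _ _ (hD0 x) hx]
      congr 2
      rw [hκe]; field_simp; ring
    calc ‖ζ x‖ₑ ^ p * (D x ^ p)⁻¹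
        ≤ ((∫⁻ s in Ioo 0 t, G (x + s • u) ^ p * (ENNReal.ofReal (t - s) ^ (1 / p)) ^ (p - 1))
            * ENNReal.ofReal (t ^ κ / κ) ^ (p - 1)) * (D x ^ p)⁻¹ := by
          gcongr
          exact (ENNReal.rpow_le_rpow h1 hp0.le).trans h2
      _ = k ^ (p - 1) * ((∫⁻ s in Ioo 0 t,
            G (x + s • u) ^ p * (ENNReal.ofReal (t - s) ^ (1 / p)) ^ (p - 1))
            * D x ^ (-1 - κ)) := by
          rw [mul_assoc, h3]; ring
      _ = k ^ (p - 1) * ∫⁻ s in Ioo 0 t, F (x, s) := by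
          rw [← lintegral_mul_const' _ _ (by
            rw [hDt, ENNReal.ofReal_rpow_of_pos ht0]; exact ENNReal.ofReal_ne_top)]
          congr 1
          refine setLIntegral_congr_fun measurableSet_Ioo fun s hs => ?_
          have hlt : ENNReal.ofReal s < D x := by
            rw [hDt]; exact (ENNReal.ofReal_lt_ofReal_iff ht0).2 hs.2
          have hmem : (x, s) ∈ {z : E × ℝ | ENNReal.ofReal z.2 < D z.1 ∧ D z.1 ≠ ⊤} := ⟨hlt, hx⟩
          simp only [hF]
          rw [indicator_of_mem hmem, ENNReal.ofReal_sub _ hs.1.le, ← hDt, ← ENNReal.rpow_mul]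
          congr 3
          rw [hκe]; ring
      _ ≤ k ^ (p - 1) * ∫⁻ s in Ioi (0 : ℝ), F (x, s) := by
          gcongr
          exact Ioo_subset_Ioi_self
  -- Translated along `u`, the kernel is at most a multiple of `(D y + s) ^ (-1 - κ)`.
  have hker : ∀ y, ∫⁻ s in Ioi (0 : ℝ), F (y - s • u, s) ≤ k * Ω.indicator (fun x => G x ^ p) y := by
    intro y
    by_cases hy : D y = ⊤
    · have : ∀ s ∈ Ioi (0 : ℝ), F (y - s • u, s) = 0 := by
        intro s hs
        refine indicator_of_notMem ?_ _
        rintro ⟨h1, h2⟩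
        have := hDsub _ s hs h1 h2
        rw [sub_add_cancel, hy] at this
        exact (ENNReal.sub_ne_top h2) this.symm
      rw [setLIntegral_congr_fun measurableSet_Ioi this]
      simp
    have hyΩ : y ∈ Ω := by
      by_contra h; exact hy (hΩ y h)
    set t := (D y).toReal with ht
    have hDt : D y = ENNReal.ofReal t := (ENNReal.ofReal_toReal hy).symm
    have ht0 : 0 < t := ENNReal.toReal_pos (hD0 y) hy
    calc ∫⁻ s in Ioi (0 : ℝ), F (y - s • u, s)
        ≤ ∫⁻ s in Ioi (0 : ℝ),
            G y ^ p * D y ^ κ * (ENNReal.ofReal t + ENNReal.ofReal s) ^ (-1 - κ) := by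
          refine setLIntegral_mono_ae (by fun_prop) (Filter.Eventually.of_forall fun s hs => ?_)
          refine indicator_apply_le' (fun hz => ?_) fun _ => zero_le
          obtain ⟨h1, h2⟩ := hz
          have h := hDsub _ s hs h1 h2
          simp only at h1 h2 ⊢
          rw [sub_add_cancel] at h ⊢
          rw [← h, ← hDt, h, tsub_add_cancel_of_le h1.le]
      _ = G y ^ p * D y ^ κ * ENNReal.ofReal (t ^ (-κ) / κ) := by
          rw [lintegral_const_mul _ (by fun_prop), setLIntegral_Ioi_add_rpow_neg hκ0 ht0]
      _ = k * G y ^ p := by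
          rw [div_eq_mul_inv, ENNReal.ofReal_mul (by positivity), ← hk,
            ← ENNReal.ofReal_rpow_of_pos ht0, ← hDt, mul_assoc, ← mul_assoc (D y ^ κ),
            ← ENNReal.rpow_add _ _ (hD0 y) hy]
          simp [mul_comm]
      _ = k * Ω.indicator (fun x => G x ^ p) y := by rw [indicator_of_mem hyΩ]
  have hmain : ∫⁻ x in Ω, ‖ζ x‖ₑ ^ p * (D x ^ p)⁻¹ ≤ k ^ p * ∫⁻ x in Ω, G x ^ p := by
    have hshift : Measurable (Function.uncurry fun (y : E) (s : ℝ) => F (y - s • u, s)) :=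
      hFm.comp (g := F) (f := fun z : E × ℝ => (z.1 - z.2 • u, z.2)) (by fun_prop)
    calc ∫⁻ x in Ω, ‖ζ x‖ₑ ^ p * (D x ^ p)⁻¹
        ≤ ∫⁻ x, k ^ (p - 1) * ∫⁻ s in Ioi (0 : ℝ), F (x, s) :=
          lintegral_mono' Measure.restrict_le_self hpt
      _ = k ^ (p - 1) * ∫⁻ s in Ioi (0 : ℝ), ∫⁻ x, F (x, s) := by
          rw [lintegral_const_mul _ hFm.lintegral_prod_right', lintegral_lintegral_swap]
          exact hFm.aemeasurable
      _ = k ^ (p - 1) * ∫⁻ s in Ioi (0 : ℝ), ∫⁻ y, F (y - s • u, s) := by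
          congr 1
          refine lintegral_congr fun s => ?_
          exact (lintegral_sub_right_eq_self (fun x => F (x, s)) (s • u)).symm
      _ = k ^ (p - 1) * ∫⁻ y, ∫⁻ s in Ioi (0 : ℝ), F (y - s • u, s) := by
          rw [← lintegral_lintegral_swap hshift.aemeasurable]
      _ ≤ k ^ (p - 1) * ∫⁻ y, k * Ω.indicator (fun x => G x ^ p) y := by
          gcongr with y
          exact hker y
      _ = k ^ p * ∫⁻ x in Ω, G x ^ p := by
          have hkp : k ^ p = k ^ (p - 1) * k := by
            conv_lhs => rw [show p = (p - 1) + 1 by ring]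
            rw [ENNReal.rpow_add_of_nonneg _ _ hp1.le zero_le_one, ENNReal.rpow_one]
          rw [lintegral_const_mul' _ _ ENNReal.ofReal_ne_top, lintegral_indicator hΩm, hkp,
            mul_assoc]
  calc _ ≤ ENNReal.ofReal (((p - 1) / p) ^ p) * (k ^ p * ∫⁻ x in Ω, G x ^ p) := by gcongr
    _ = ∫⁻ x in Ω, G x ^ p := by
        rw [← mul_assoc, hk, ENNReal.ofReal_rpow_of_nonneg (by positivity) hp0.le,
          ← ENNReal.ofReal_mul (by positivity), ← Real.mul_rpow (by positivity) (by positivity),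
          ← hκe, mul_inv_cancel₀ hκ0.ne']
        simp

end Directional

/-! ### The distance to the Dirichlet boundary in a direction -/

lemma mul_lintegral_mul_average_le {α β : Type*} [MeasurableSpace α] [MeasurableSpace β]
    {μ : Measure α} {σ : Measure β} [SFinite μ] [SFinite σ] {g : α → ℝ≥0∞} {f : α → β → ℝ≥0∞}
    (hg : Measurable g) (hf : Measurable (Function.uncurry f)) {c I : ℝ≥0∞}
    (h : ∀ u, c * ∫⁻ x, g x * f x u ∂μ ≤ I) :
    c * ∫⁻ x, g x * ((∫⁻ u, f x u ∂σ) / σ univ) ∂μ ≤ I := by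
  have hgf : Measurable (Function.uncurry fun x u => g x * f x u) :=
    (hg.comp measurable_fst).mul hf
  have e : ∀ x, g x * ((∫⁻ u, f x u ∂σ) / σ univ) = (∫⁻ u, g x * f x u ∂σ) * (σ univ)⁻¹ := by
    intro x
    have hx : Measurable (f x) := hf.comp measurable_prodMk_left
    rw [lintegral_const_mul _ hx, div_eq_mul_inv, mul_assoc]
  have hl : Measurable fun x => ∫⁻ u, g x * f x u ∂σ := hgf.lintegral_prod_right'
  have hr : Measurable fun u => ∫⁻ x, g x * f x u ∂μ := hgf.lintegral_prod_left'
  simp only [e]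
  rw [lintegral_mul_const _ hl, lintegral_lintegral_swap hgf.aemeasurable, ← mul_assoc,
    ← lintegral_const_mul _ hr]
  calc _ ≤ (∫⁻ _, I ∂σ) * (σ univ)⁻¹ := by
        gcongr with u
        exact h u
    _ = I * (σ univ * (σ univ)⁻¹) := by rw [lintegral_const, mul_assoc]
    _ ≤ I * 1 := by
        gcongr
        exact ENNReal.mul_inv_le_one _
    _ = I := mul_one _

section DirichletDist

variable {d : ℕ} {Ω ΓD : Set (EuclideanSpace ℝ (Fin d))} {x u : EuclideanSpace ℝ (Fin d)}

lemma dirichletDist_eq_ofReal (hΩ : IsOpen Ω) (hΓD : ΓD ⊆ frontier Ω) {t : ℝ}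
    (ht : 0 < t ∧ x + t • u ∈ ΓD ∧ ∀ s ∈ Ico 0 t, x + s • u ∈ Ω) :
    dirichletDist Ω ΓD x u = ENNReal.ofReal t := by
  refine le_antisymm (iInf₂_le t ht) (le_iInf₂ fun t' ht' => ENNReal.ofReal_le_ofReal ?_)
  by_contra! hlt
  have h1 := hΓD ht'.2.1
  rw [hΩ.frontier_eq] at h1
  exact h1.2 (ht.2.2 t' ⟨ht'.1.le, hlt⟩)

lemma exists_of_dirichletDist_ne_top (h : dirichletDist Ω ΓD x u ≠ ⊤) :
    ∃ t : ℝ, 0 < t ∧ x + t • u ∈ ΓD ∧ ∀ s ∈ Ico 0 t, x + s • u ∈ Ω := by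
  by_contra hn
  refine h ?_
  simp only [dirichletDist, iInf_eq_top]
  exact fun t ht => absurd ⟨t, ht⟩ hn

lemma dirichletDist_ne_zero (hΩ : IsOpen Ω) (hΓD : ΓD ⊆ frontier Ω) :
    dirichletDist Ω ΓD x u ≠ 0 := by
  intro h
  obtain ⟨t, ht⟩ := exists_of_dirichletDist_ne_top (h ▸ ENNReal.zero_ne_top)
  rw [dirichletDist_eq_ofReal hΩ hΓD ht, ENNReal.ofReal_eq_zero] at h
  exact not_lt.2 h ht.1

lemma dirichletDist_eq_top_of_notMem (hx : x ∉ Ω) : dirichletDist Ω ΓD x u = ⊤ := by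
  by_contra h
  obtain ⟨t, ht0, -, ht⟩ := exists_of_dirichletDist_ne_top h
  exact hx (by simpa using ht 0 ⟨le_rfl, ht0⟩)

lemma dirichletDist_add_smul (hΩ : IsOpen Ω) (hΓD : ΓD ⊆ frontier Ω) {s : ℝ} (hs : 0 < s)
    (hlt : ENNReal.ofReal s < dirichletDist Ω ΓD x u) (htop : dirichletDist Ω ΓD x u ≠ ⊤) :
    dirichletDist Ω ΓD (x + s • u) u = dirichletDist Ω ΓD x u - ENNReal.ofReal s := by
  obtain ⟨t, ht⟩ := exists_of_dirichletDist_ne_top htop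
  rw [dirichletDist_eq_ofReal hΩ hΓD ht] at hlt ⊢
  have hst : s < t := (ENNReal.ofReal_lt_ofReal_iff ht.1).1 hlt
  rw [← ENNReal.ofReal_sub _ hs.le]
  have e : ∀ r : ℝ, x + s • u + r • u = x + (s + r) • u := fun r => by rw [add_smul, add_assoc]
  refine dirichletDist_eq_ofReal hΩ hΓD ⟨sub_pos.2 hst, ?_, fun r hr => ?_⟩
  · rw [e, add_sub_cancel]; exact ht.2.1
  · rw [e]; exact ht.2.2 _ ⟨add_nonneg hs.le hr.1, by linarith [hr.2]⟩

/-- The time at which the ray `x + s • u`, `s ≥ 0`, first leaves `Ω`, for `z = (x, u)`. It is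
written as a supremum over rational times so as to be visibly measurable. -/
noncomputable def exitTime (Ω : Set (EuclideanSpace ℝ (Fin d)))
    (z : EuclideanSpace ℝ (Fin d) × EuclideanSpace ℝ (Fin d)) : ℝ≥0∞ :=
  ⨆ q : ℚ, {z : EuclideanSpace ℝ (Fin d) × EuclideanSpace ℝ (Fin d) |
    ∀ s ∈ Icc (0 : ℝ) q, z.1 + s • z.2 ∈ Ω}.indicator (fun _ => ENNReal.ofReal q) z

lemma measurable_exitTime (hΩ : IsOpen Ω) : Measurable (exitTime Ω) := by
  refine Measurable.iSup fun q => Measurable.indicator measurable_const ?_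
  refine IsOpen.measurableSet ?_
  refine isOpen_iff_mem_nhds.2 fun z hz => ?_
  refine isCompact_Icc.eventually_forall_of_forall_eventually (fun s hs => ?_)
  have hc : Continuous fun w : (EuclideanSpace ℝ (Fin d) × EuclideanSpace ℝ (Fin d)) × ℝ =>
      w.1.1 + w.2 • w.1.2 := by fun_prop
  exact (hΩ.preimage hc).mem_nhds (hz s hs)

lemma exitTime_eq_ofReal (hΩ : IsOpen Ω) (hΓD : ΓD ⊆ frontier Ω) {t : ℝ}
    (ht : 0 < t ∧ x + t • u ∈ ΓD ∧ ∀ s ∈ Ico 0 t, x + s • u ∈ Ω) :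
    exitTime Ω (x, u) = ENNReal.ofReal t := by
  refine le_antisymm (iSup_le fun q => indicator_apply_le' (fun hq => ?_) fun _ => zero_le) ?_
  · refine ENNReal.ofReal_le_ofReal ?_
    by_contra! hlt
    have h1 := hΓD ht.2.1
    rw [hΩ.frontier_eq] at h1
    exact h1.2 (hq t ⟨ht.1.le, hlt.le⟩)
  · refine le_of_forall_lt fun c hc => ?_
    obtain ⟨q, -, hcq, hqt⟩ := ENNReal.lt_iff_exists_rat_btwn.1 hc
    refine hcq.trans_le (le_iSup_of_le q ?_)
    have hqt' : (q : ℝ) < t := (ENNReal.ofReal_lt_ofReal_iff ht.1).1 hqt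
    rw [indicator_of_mem]
    · rfl
    · exact fun s hs => ht.2.2 s ⟨hs.1, hs.2.trans_lt hqt'⟩

/-- The directional distance is the exit time where the exit point is in `ΓD`, so that its
measurability does not require projecting a Borel set. -/
lemma dirichletDist_eq_ite (hΩ : IsOpen Ω) (hΓD : ΓD ⊆ frontier Ω)
    (z : EuclideanSpace ℝ (Fin d) × EuclideanSpace ℝ (Fin d)) [Decidable
      (z.1 ∈ Ω ∧ exitTime Ω z ≠ ⊤ ∧ z.1 + (exitTime Ω z).toReal • z.2 ∈ ΓD)] :
    dirichletDist Ω ΓD z.1 z.2 =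
      if z.1 ∈ Ω ∧ exitTime Ω z ≠ ⊤ ∧ z.1 + (exitTime Ω z).toReal • z.2 ∈ ΓD
        then exitTime Ω z else ⊤ := by
  obtain ⟨x, u⟩ := z
  split_ifs with h
  · obtain ⟨hx, htop, hD⟩ := h
    have h0 : exitTime Ω (x, u) ≠ 0 := by
      intro h0
      have h1 := hΓD hD
      rw [hΩ.frontier_eq] at h1
      exact h1.2 (by simpa [h0] using hx)
    rw [← ENNReal.ofReal_toReal htop]
    refine dirichletDist_eq_ofReal hΩ hΓD ⟨ENNReal.toReal_pos h0 htop, hD, fun s hs => ?_⟩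
    have hs' : ENNReal.ofReal s < exitTime Ω (x, u) :=
      (ENNReal.ofReal_lt_iff_lt_toReal hs.1 htop).2 hs.2
    obtain ⟨q, hq⟩ := lt_iSup_iff.1 hs'
    have hmem := mem_of_indicator_ne_zero (pos_of_gt hq).ne'
    rw [indicator_of_mem hmem] at hq
    exact hmem s ⟨hs.1, (ENNReal.lt_ofReal_iff_toReal_lt ENNReal.ofReal_ne_top).1 hq |>.le.trans'
      (by rw [ENNReal.toReal_ofReal hs.1])⟩
  · by_contra hne
    obtain ⟨t, ht⟩ := exists_of_dirichletDist_ne_top hne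
    refine h ⟨by simpa using ht.2.2 0 ⟨le_rfl, ht.1⟩, ?_⟩
    rw [exitTime_eq_ofReal hΩ hΓD ht, ENNReal.toReal_ofReal ht.1.le]
    exact ⟨ENNReal.ofReal_ne_top, ht.2.1⟩

lemma measurable_dirichletDist (hΩ : IsOpen Ω) (hΓD : ΓD ⊆ frontier Ω)
    (hΓDm : MeasurableSet ΓD) :
    Measurable fun z : EuclideanSpace ℝ (Fin d) × EuclideanSpace ℝ (Fin d) =>
      dirichletDist Ω ΓD z.1 z.2 := by
  classical
  have hτ := measurable_exitTime hΩ
  simp only [dirichletDist_eq_ite hΩ hΓD]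
  refine Measurable.ite ?_ hτ measurable_const
  refine (measurable_fst hΩ.measurableSet).inter (MeasurableSet.inter ?_ ?_)
  · exact (hτ (measurableSet_singleton ⊤)).compl
  · exact (measurable_fst.add (hτ.ennreal_toReal.smul measurable_snd)) hΓDm

lemma lintegral_rpow_mul_inv_dirichletDist_le (hΩ : IsOpen Ω) (hΓD : ΓD ⊆ frontier Ω)
    (hΓDm : MeasurableSet ΓD) {ζ : EuclideanSpace ℝ (Fin d) → ℝ} (hζ : ContDiff ℝ 1 ζ)
    (hζD : ∀ y ∈ ΓD, ζ y = 0) {p : ℝ} (hp : 1 < p) (hu : ‖u‖ = 1) :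
    ENNReal.ofReal (((p - 1) / p) ^ p) *
        (∫⁻ x in Ω, ‖ζ x‖ₑ ^ p * (dirichletDist Ω ΓD x u ^ p)⁻¹)
      ≤ ∫⁻ x in Ω, ‖gradient ζ x‖ₑ ^ p := by
  refine lintegral_rpow_mul_inv_rpow_le_of_direction hζ hp hu
    ((measurable_dirichletDist hΩ hΓD hΓDm).comp measurable_prodMk_right)
    (fun x => dirichletDist_ne_zero hΩ hΓD) (fun x t ht hx => ?_)
    (fun x s hs => dirichletDist_add_smul hΩ hΓD hs)
    (fun x hx => dirichletDist_eq_top_of_notMem hx) hΩ.measurableSet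
  have hx : dirichletDist Ω ΓD x u = ENNReal.ofReal t := hx
  obtain ⟨t', ht'⟩ := exists_of_dirichletDist_ne_top (hx ▸ ENNReal.ofReal_ne_top)
  rw [dirichletDist_eq_ofReal hΩ hΓD ht',
    ENNReal.ofReal_eq_ofReal_iff ht'.1.le ht.le] at hx
  exact hζD _ (hx ▸ ht'.2.1)

lemma lintegral_rpow_mul_invMeanDistPow_le (hΩ : IsOpen Ω) (hΓD : ΓD ⊆ frontier Ω)
    (hΓDm : MeasurableSet ΓD) {ζ : EuclideanSpace ℝ (Fin d) → ℝ} (hζ : ContDiff ℝ 1 ζ)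
    (hζD : ∀ y ∈ ΓD, ζ y = 0) {p : ℝ} (hp : 1 < p) :
    ENNReal.ofReal (((p - 1) / p) ^ p) *
        (∫⁻ x in Ω, ‖ζ x‖ₑ ^ p * invMeanDistPow Ω ΓD p x)
      ≤ ∫⁻ x in Ω, ‖gradient ζ x‖ₑ ^ p := by
  have hDm : Measurable (Function.uncurry fun (x : EuclideanSpace ℝ (Fin d))
      (u : sphere (0 : EuclideanSpace ℝ (Fin d)) 1) => (dirichletDist Ω ΓD x u ^ p)⁻¹) :=
    (((measurable_dirichletDist hΩ hΓD hΓDm).comp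
      (measurable_fst.prodMk (measurable_subtype_coe.comp measurable_snd))).pow_const p).inv
  exact mul_lintegral_mul_average_le (hζ.continuous.measurable.enorm.pow_const p) hDm fun u =>
    lintegral_rpow_mul_inv_dirichletDist_le hΩ hΓD hΓDm hζ hζD hp (by simp)

end DirichletDist

/-! ### Lower bounds for the fundamental eigenvalue -/

section Eigenvalue

variable {d : ℕ} {Ω ΓD : Set (EuclideanSpace ℝ (Fin d))} {p : ℝ}

lemma IsTestFunction.eq_zero {ζ : EuclideanSpace ℝ (Fin d) → ℝ} (hζ : IsTestFunction ΓD ζ)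
    {y : EuclideanSpace ℝ (Fin d)} (hy : y ∈ ΓD) : ζ y = 0 :=
  image_eq_zero_of_notMem_tsupport fun h => disjoint_left.1 hζ.2.2 h hy

/-- A Hardy inequality with potential `V` bounds the fundamental eigenvalue below by `inf V`. -/
lemma iInf_le_fundamentalEigenvalue (hΩ : IsOpen Ω) (hp : 0 < p)
    (V : EuclideanSpace ℝ (Fin d) → ℝ≥0∞)
    (h : ∀ ζ, IsTestFunction ΓD ζ →
      ∫⁻ x in Ω, ‖ζ x‖ₑ ^ p * V x ≤ ∫⁻ x in Ω, ‖gradient ζ x‖ₑ ^ p) :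
    ⨅ x ∈ Ω, V x ≤ fundamentalEigenvalue Ω ΓD p := by
  refine le_iInf fun ζ => le_iInf fun hζ => le_iInf fun ⟨x₀, hx₀, hζx₀⟩ => ?_
  have hc : Continuous ζ := hζ.1.continuous
  have hm : Measurable fun x => ‖ζ x‖ₑ ^ p := hc.measurable.enorm.pow_const p
  have hne : ∫⁻ x in Ω, ‖ζ x‖ₑ ^ p ≠ 0 := by
    rw [Ne, lintegral_eq_zero_iff hm, Filter.EventuallyEq, ae_restrict_iff' hΩ.measurableSet,
      ae_iff]
    have ho : IsOpen (Ω ∩ ζ ⁻¹' {0}ᶜ) := hΩ.inter (isOpen_compl_singleton.preimage hc)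
    refine ((ho.measure_pos volume ⟨x₀, hx₀, hζx₀⟩).trans_le (measure_mono ?_)).ne'
    rintro x ⟨hx, hζx⟩
    have hζx' : ζ x ≠ 0 := hζx
    simpa [hx, hp, hp.not_gt] using hζx'
  have htop : ∫⁻ x in Ω, ‖ζ x‖ₑ ^ p ≠ ⊤ := by
    have h1 : MemLp ζ (ENNReal.ofReal p) volume := hc.memLp_of_hasCompactSupport hζ.2.1
    have h2 := lintegral_rpow_enorm_lt_top_of_eLpNorm_lt_top (by simpa using hp)
      ENNReal.ofReal_ne_top h1.2
    rw [ENNReal.toReal_ofReal hp.le] at h2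
    exact ((setLIntegral_le_lintegral _ _).trans_lt h2).ne
  rw [ENNReal.le_div_iff_mul_le (Or.inl hne) (Or.inl htop), ← lintegral_const_mul _ hm]
  refine le_trans (setLIntegral_mono' hΩ.measurableSet fun x hx => ?_) (h ζ hζ)
  rw [mul_comm]
  gcongr
  exact iInf₂_le x hx

lemma rpow_mul_ofReal_div_rpow (hp : 0 ≤ p) {c : ℝ} (hc : 0 ≤ c) (a b : ℝ≥0∞) :
    a ^ p * (ENNReal.ofReal c / b) ^ p = ENNReal.ofReal (c ^ p) * (a / b) ^ p := by
  rw [div_eq_mul_inv, div_eq_mul_inv, ENNReal.mul_rpow_of_nonneg _ _ hp,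
    ENNReal.mul_rpow_of_nonneg _ _ hp, ENNReal.ofReal_rpow_of_nonneg hc hp]
  ring

/-- The rays from `0` that meet the exceptional null set of the starlikeness condition fill only
a Lebesgue null set; every other ray enters `Ω` through `ΓD`. -/
lemma ae_exists_smul_mem_of_isStarlikeExteriorAway (hd : 0 < d) (hΩ : IsOpen Ω)
    (h0 : (0 : EuclideanSpace ℝ (Fin d)) ∉ closure Ω)
    (hstar : IsStarlikeExteriorAway Ω (frontier Ω \ ΓD)) :
    ∀ᵐ x ∂(volume.restrict Ω), ∃ a ∈ Ioo (0 : ℝ) 1, a • x ∈ ΓD ∧ ∀ s ∈ Ioo a 1, s • x ∈ Ω := by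
  obtain ⟨m, rfl⟩ : ∃ m, d = m + 1 := ⟨d - 1, by omega⟩
  rw [IsStarlikeExteriorAway, ae_iff, show ((m + 1 : ℕ) : ℝ) - 1 = m by push_cast; ring] at hstar
  have hnull := measure_cone_eq_zero_of_hausdorffMeasure_eq_zero
    (volume : Measure (EuclideanSpace ℝ (Fin (m + 1)))) (by simp) hstar
  rw [ae_restrict_iff' hΩ.measurableSet]
  filter_upwards [compl_mem_ae_iff.2 hnull] with x hx hxΩ
  refine exists_smul_mem_of_starlike hΩ h0 hxΩ fun y hy ⟨s, hs, hsy⟩ => ?_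
  by_contra hn
  exact hx ⟨s, hs, y, fun h => hn (h hy), hsy⟩

end Eigenvalue

theorem mainTheorem3 (d : ℕ) (p : ℝ) (hp : (d : ℝ) < p)
    (Ω ΓD : Set (EuclideanSpace ℝ (Fin d)))
    (hΩo : IsOpen Ω) (hΩc : IsConnected Ω) (hΩb : Bornology.IsBounded Ω)
    (hΓD : ΓD ⊆ frontier Ω) (hΓDm : MeasurableSet ΓD)
    (h0 : (0 : EuclideanSpace ℝ (Fin d)) ∉ closure Ω)
    (hstar : IsStarlikeExteriorAway Ω (frontier Ω \ ΓD)) :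
    (∀ ζ : EuclideanSpace ℝ (Fin d) → ℝ, IsTestFunction ΓD ζ →
      ENNReal.ofReal (((p - d) / p) ^ p) * (∫⁻ x in Ω, (‖ζ x‖ₑ / ‖x‖ₑ) ^ p)
        ≤ ∫⁻ x in Ω, ‖gradient ζ x‖ₑ ^ p) ∧
    (ENNReal.ofReal ((p - d) / p) / ⨆ x ∈ Ω, ‖x‖ₑ) ^ p ≤ fundamentalEigenvalue Ω ΓD p ∧
    (2 ≤ p → ∀ γ : ℝ, 0 ≤ γ → γ ≤ 1 →
      (⨅ x ∈ Ω,
        (ENNReal.ofReal γ * (ENNReal.ofReal ((p - d) / p) / ‖x‖ₑ) ^ p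
          + ENNReal.ofReal (1 - γ)
            * (ENNReal.ofReal ((p - 1) ^ (p - 2) / p ^ p) * invMeanDistPow Ω ΓD p x)))
        ≤ fundamentalEigenvalue Ω ΓD p) := by
  -- In dimension zero the only point of `Ω` would be the origin.
  have hd : 0 < d := by
    rcases Nat.eq_zero_or_pos d with rfl | hd
    · obtain ⟨x, hx⟩ := hΩc.nonempty
      exact absurd (subset_closure (Subsingleton.elim x 0 ▸ hx)) h0
    · exact hd
  have hd1 : (1 : ℝ) ≤ d := by exact_mod_cast hd
  have hp1 : 1 < p := by linarith
  have hp0 : 0 < p := by linarith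
  have hc : 0 ≤ (p - d) / p := div_nonneg (by linarith) hp0.le
  have hray := ae_exists_smul_mem_of_isStarlikeExteriorAway hd hΩo h0 hstar
  have hC1 : ∀ {ζ}, IsTestFunction ΓD ζ → ContDiff ℝ 1 ζ := fun hζ => hζ.1.of_le (by simp)
  have hardy : ∀ ζ : EuclideanSpace ℝ (Fin d) → ℝ, IsTestFunction ΓD ζ →
      ENNReal.ofReal (((p - d) / p) ^ p) * (∫⁻ x in Ω, (‖ζ x‖ₑ / ‖x‖ₑ) ^ p)
        ≤ ∫⁻ x in Ω, ‖gradient ζ x‖ₑ ^ p := fun ζ hζ => by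
    have h := lintegral_div_norm_rpow_le_of_radial (hC1 hζ) hp1 (by simpa using hp) hΩo
      (hray.mono fun x ⟨a, ha, haD, hin⟩ => ⟨a, ha, hζ.eq_zero haD, hin⟩)
    simpa using h
  have hardy' : ∀ ζ : EuclideanSpace ℝ (Fin d) → ℝ, IsTestFunction ΓD ζ →
      ∫⁻ x in Ω, ‖ζ x‖ₑ ^ p * (ENNReal.ofReal ((p - d) / p) / ‖x‖ₑ) ^ p
        ≤ ∫⁻ x in Ω, ‖gradient ζ x‖ₑ ^ p := fun ζ hζ => by
    simp only [rpow_mul_ofReal_div_rpow hp0.le hc]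
    rw [lintegral_const_mul' _ _ ENNReal.ofReal_ne_top]
    exact hardy ζ hζ
  refine ⟨hardy, ?_, fun hp2 γ hγ0 hγ1 => ?_⟩
  · refine le_trans (le_iInf₂ fun x hx => ?_) (iInf_le_fundamentalEigenvalue hΩo hp0 _ hardy')
    gcongr
    exact le_iSup₂ (f := fun (x : EuclideanSpace ℝ (Fin d)) (_ : x ∈ Ω) => ‖x‖ₑ) x hx
  · refine iInf_le_fundamentalEigenvalue hΩo hp0 _ fun ζ hζ => ?_
    set I := ∫⁻ x in Ω, ‖gradient ζ x‖ₑ ^ p with hI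
    have hconst : (p - 1) ^ (p - 2) / p ^ p ≤ ((p - 1) / p) ^ p := by
      rw [Real.div_rpow (by linarith) hp0.le]
      gcongr <;> linarith
    have hmean := lintegral_rpow_mul_invMeanDistPow_le hΩo hΓD hΓDm (hC1 hζ)
      (fun y hy => hζ.eq_zero hy) hp1
    have hV : Measurable fun x : EuclideanSpace ℝ (Fin d) =>
        ‖ζ x‖ₑ ^ p * (ENNReal.ofReal ((p - d) / p) / ‖x‖ₑ) ^ p :=
      (hζ.1.continuous.measurable.enorm.pow_const p).mul
        ((measurable_const.div measurable_enorm).pow_const p)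
    calc ∫⁻ x in Ω, ‖ζ x‖ₑ ^ p * (ENNReal.ofReal γ * (ENNReal.ofReal ((p - d) / p) / ‖x‖ₑ) ^ p
          + ENNReal.ofReal (1 - γ)
            * (ENNReal.ofReal ((p - 1) ^ (p - 2) / p ^ p) * invMeanDistPow Ω ΓD p x))
        = ∫⁻ x in Ω, (ENNReal.ofReal γ *
            (‖ζ x‖ₑ ^ p * (ENNReal.ofReal ((p - d) / p) / ‖x‖ₑ) ^ p)
          + ENNReal.ofReal (1 - γ) * (ENNReal.ofReal ((p - 1) ^ (p - 2) / p ^ p) *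
            (‖ζ x‖ₑ ^ p * invMeanDistPow Ω ΓD p x))) := by
          refine lintegral_congr fun x => ?_
          ring
      _ = ENNReal.ofReal γ *
            (∫⁻ x in Ω, ‖ζ x‖ₑ ^ p * (ENNReal.ofReal ((p - d) / p) / ‖x‖ₑ) ^ p)
          + ENNReal.ofReal (1 - γ) * (ENNReal.ofReal ((p - 1) ^ (p - 2) / p ^ p) *
            ∫⁻ x in Ω, ‖ζ x‖ₑ ^ p * invMeanDistPow Ω ΓD p x) := by
          rw [lintegral_add_left (hV.const_mul _), lintegral_const_mul' _ _ ENNReal.ofReal_ne_top,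
            lintegral_const_mul' _ _ ENNReal.ofReal_ne_top,
            lintegral_const_mul' _ _ ENNReal.ofReal_ne_top]
      _ ≤ ENNReal.ofReal γ * I + ENNReal.ofReal (1 - γ) * I := by
          gcongr
          · exact hardy' ζ hζ
          · exact le_trans (by gcongr) hmean
      _ = I := by
          rw [← add_mul, ← ENNReal.ofReal_add hγ0 (by linarith), add_sub_cancel,
            ENNReal.ofReal_one, one_mul]
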